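/- Let $d\ge 1$ and let the group $C_d\times C_d$ of cyclic translations act on $d\times d$ images $x=(x_p)\in\mathbb R^{d\times d}$ by shifting both pixel coordinates modulo $d$. For $k\ge 0$ it acts on the tensors of order $k$ over the $n=d^2$ pixels with $a$ channels, $\mathbb R^{n^k\times a}$, by shifting all $k$ pixel indices simultaneously. Given an activation function $\sigma:\mathbb R\to\mathbb R$ (applied entrywise), an *invariant neural network* is a function $$F=M\circ h\circ L_D\circ\sigma\circ\cdots\circ\sigma\circ L_1:\ \mathbb R^{d\times d}\to\mathbb R ,\qquad D\ge 1,$$ where the layers $L_i:\mathbb R^{n^{k_i}\times a_i}\to\mathbb R^{n^{k_{i+1}}\times a_{i+1}}$ are $C_d\times C_d$-equivariant, $k_1=a_1=1$, $h:\mathbb R^{n^{k_{D+1}}\times a_{D+1}}\to\mathbb R^m$ is a $C_d\times C_d$-invariant linear map, and $M:\mathbb R^m\to\mathbb R$ is a multi-layer perceptron with activation $\sigma$ (affine maps alternating with entrywise $\sigma$). Its tensor sizes are the orders $k_1,\dots,k_{D+1}$. Let $f:\mathbb R^{d\times d}\to\mathbb R$ be continuous and invariant under $C_d\times C_d$, let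 $K\subset\mathbb R^{d\times d}$ be compact and let $\varepsilon>0$. Then there is an invariant neural network $F$ with all tensor sizes $\le 2d-1$ such that $|F(x)-f(x)|<\varepsilon$ for all $x\in K$. This holds 1. for every continuous non-polynomial activation function $\sigma$, when the equivariant layers $L_i$ are allowed to be affine (i.e. to have equivariant biases); 2. for $\sigma$ the ReLU $t\mapsto\max(t,0)$ and for $\sigma$ the logistic sigmoid $t\mapsto 1/(1+e^{-t})$, even when all equivariant layers $L_i$ are required to be linear, without biases. -/

import Mathlib

/-!
Neural networks invariant to a set of permutations of the input coordinates.

The coordinates of an input are indexed by a type `ι` (for images: the pixels), and `P` is the set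
of permutations of `ι` that the network has to respect.
-/

/-- The space `ℝ^{n^k × a}`, `n = |ι|`: tensors of order `k` over the index set `ι`, with `a`
channels. The entry of `X` at `(i_1, …, i_k)` in the channel `c` is `X i c`. -/
abbrev Tensor (ι : Type*) (k a : ℕ) : Type _ := (Fin k → ι) → Fin a → ℝ

/-- A permutation acts on a tensor by permuting the indices in all `k` axes simultaneously. -/
def permTensor {ι : Type*} {k a : ℕ} (π : Equiv.Perm ι) (X : Tensor ι k a) : Tensor ι k a :=
  fun i c => X (fun s => π (i s)) c

/-- The activation function is applied to every entry of a tensor. -/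
def activate {ι : Type*} {k a : ℕ} (σ : ℝ → ℝ) (X : Tensor ι k a) : Tensor ι k a :=
  fun i c => σ (X i c)

/-- An input vector, seen as a tensor of order one with one channel. -/
def inputTensor {ι : Type*} (x : ι → ℝ) : Tensor ι 1 1 := fun i _ => x (i 0)

/-- Whether the equivariant layers of a network are linear maps, or affine maps
(that is, linear maps followed by the addition of a bias). -/
inductive LayerKind where
  | linear
  | affine

/-- `f` is an equivariant layer `ℝ^{n^k × a} → ℝ^{n^l × b}`: a linear equivariant map, to which,
if layers are allowed to be affine, a bias tensor fixed by `P` is added (an affine map is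
equivariant if and only if its linear part is equivariant and its constant part is fixed). -/
def IsEquivariantLayer {ι : Type*} (P : Set (Equiv.Perm ι)) (κ : LayerKind) {k a l b : ℕ}
    (f : Tensor ι k a → Tensor ι l b) : Prop :=
  ∃ (L : Tensor ι k a →ₗ[ℝ] Tensor ι l b) (c : Tensor ι l b),
    (∀ π ∈ P, ∀ X, L (permTensor π X) = permTensor π (L X)) ∧
    (∀ π ∈ P, permTensor π c = c) ∧
    (κ = LayerKind.linear → c = 0) ∧
    ∀ X, f X = L X + c

/-- `h` is an invariant (linear) layer `ℝ^{n^k × a} → ℝ^m`. -/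
def IsInvariantLayer {ι : Type*} (P : Set (Equiv.Perm ι)) {k a m : ℕ}
    (h : Tensor ι k a →ₗ[ℝ] (Fin m → ℝ)) : Prop :=
  ∀ π ∈ P, ∀ X, h (permTensor π X) = h X

/-- `IsEquivariantStack P κ σ N Φ`: the map `Φ` is of the form `L_D ∘ σ ∘ ⋯ ∘ σ ∘ L_1`, `D ≥ 1`,
with equivariant layers `L_i`, an input of order one with one channel, and with all
tensors of order at most `N`. -/
inductive IsEquivariantStack {ι : Type*} (P : Set (Equiv.Perm ι)) (κ : LayerKind) (σ : ℝ → ℝ)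
    (N : ℕ) : {k a : ℕ} → (Tensor ι 1 1 → Tensor ι k a) → Prop where
  | first {k a : ℕ} (L : Tensor ι 1 1 → Tensor ι k a) (hin : 1 ≤ N) (hout : k ≤ N)
      (hL : IsEquivariantLayer P κ L) : IsEquivariantStack P κ σ N L
  | next {k a l b : ℕ} (Φ : Tensor ι 1 1 → Tensor ι k a) (L : Tensor ι k a → Tensor ι l b)
      (hΦ : IsEquivariantStack P κ σ N Φ) (hout : l ≤ N)
      (hL : IsEquivariantLayer P κ L) : IsEquivariantStack P κ σ N (fun X => L (activate σ (Φ X)))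

/-- Multi-layer perceptrons `ℝ^m → ℝ^p` with activation function `σ`: affine maps alternating with
coordinatewise applications of `σ`, of any depth and any widths. -/
inductive IsMLP (σ : ℝ → ℝ) {m : ℕ} : {p : ℕ} → ((Fin m → ℝ) → (Fin p → ℝ)) → Prop where
  | affine {p : ℕ} (A : Matrix (Fin p) (Fin m) ℝ) (b : Fin p → ℝ) :
      IsMLP σ (fun x => A.mulVec x + b)
  | next {q p : ℕ} (g : (Fin m → ℝ) → (Fin q → ℝ)) (hg : IsMLP σ g)
      (A : Matrix (Fin p) (Fin q) ℝ) (b : Fin p → ℝ) :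
      IsMLP σ (fun x => A.mulVec (fun j => σ (g x j)) + b)

/-- `F : ℝ^n → ℝ` is an invariant neural network `M ∘ h ∘ L_D ∘ σ ∘ ⋯ ∘ σ ∘ L_1` with
activation function `σ` and tensors of order at most `N`: the layers `L_i` are equivariant, the
layer `h` is invariant, and `M` is a multi-layer perceptron. -/
def IsInvariantNetwork {ι : Type*} (P : Set (Equiv.Perm ι)) (κ : LayerKind) (σ : ℝ → ℝ) (N : ℕ)
    (F : (ι → ℝ) → ℝ) : Prop :=
  ∃ (k a m : ℕ) (Φ : Tensor ι 1 1 → Tensor ι k a) (h : Tensor ι k a →ₗ[ℝ] (Fin m → ℝ))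
    (M : (Fin m → ℝ) → (Fin 1 → ℝ)),
    IsEquivariantStack P κ σ N Φ ∧ IsInvariantLayer P h ∧ IsMLP σ M ∧
    ∀ x, F x = M (h (Φ (inputTensor x))) 0

/-- The pixels of a `d × d` image, with both coordinates taken modulo `d`. -/
abbrev Pixel (d : ℕ) : Type := ZMod d × ZMod d

/-- The group `C_d × C_d` of horizontal and vertical cyclic shifts, as permutations of
the pixels. -/
def translations (d : ℕ) : Set (Equiv.Perm (Pixel d)) :=
  Set.range (fun g : ZMod d × ZMod d => Equiv.addRight g)

/-- The rectified linear unit. -/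
def relu (t : ℝ) : ℝ := max t 0

/-! Tensors of order one already suffice. A translation-equivariant map between them is determined
by its value at one pixel, so everything reduces to the space of features, the functions of an image
computed at a fixed pixel. Summing a feature over all pixels gives an invariant function, and a
perceptron with one hidden layer turns such sums `v` into combinations of ridge functions `σ (v +
b)`.

Ridge functions over a linear space `V` of continuous functions on a compact space are dense among
the continuous functions constant on the fibres of `V` (`mem_topologicalClosure_span_ridge`).
Differentiating mollifications of `σ (t v + b)` in `t` at `0` puts every power of `v` in the closed
span, because `σ` is not a polynomial; hence so is `exp v`, and exponentials span an algebra to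
which Stone–Weierstrass applies.

It remains to separate orbits by sums of features. If features separate points and the next layer
contains their ridge functions, the same density on the finite union of two orbits approximates the
indicator of one of them, and summation distinguishes the orbits. The shifts `b` come from biases,
or from `σ 0 = 1/2` for the sigmoid. Bias-free ReLU features are positively homogeneous, so there
the `ℓ¹` norm of the image replaces the constants. -/

/-! ### Closed subspaces, derivatives and integrals -/

/-- A closed subspace contains the derivatives of the curves that it contains. -/
theorem Submodule.hasDerivAt_mem {E : Type*} [NormedAddCommGroup E] [NormedSpace ℝ E]
    {S : Submodule ℝ E} (hS : IsClosed (S : Set E)) {γ : ℝ → E} (hγ : ∀ t, γ t ∈ S)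
    {γ' : E} {t : ℝ} (h : HasDerivAt γ γ' t) : γ' ∈ S := by
  rw [hasDerivAt_iff_tendsto_slope] at h
  refine hS.mem_of_tendsto h (Filter.Eventually.of_forall fun s => ?_)
  rw [slope_def_module]
  exact S.smul_mem _ (S.sub_mem (hγ _) (hγ _))

/-- A closed subspace contains the integrals of the functions with values in it. -/
theorem Submodule.integral_mem_of_forall_mem {α E : Type*} [MeasurableSpace α]
    {μ : MeasureTheory.Measure α} [NormedAddCommGroup E] [NormedSpace ℝ E] [CompleteSpace E]
    {S : Submodule ℝ E} (hS : IsClosed (S : Set E)) {F : α → E} (hF : ∀ y, F y ∈ S)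
    (hint : MeasureTheory.Integrable F μ) : ∫ y, F y ∂μ ∈ S := by
  by_contra hne
  obtain ⟨l, u, hl, hu⟩ := geometric_hahn_banach_closed_point S.convex hS hne
  -- A functional bounded above on a subspace vanishes there: otherwise some multiple of `v` attains
  -- the bound `u`.
  have hzero : ∀ v ∈ S, l v = 0 := by
    intro v hv
    by_contra hv0
    have := hl ((u / l v) • v) (S.smul_mem _ hv)
    rw [map_smul, smul_eq_mul, div_mul_cancel₀ _ hv0] at this
    exact lt_irrefl _ this
  have h0 : (0 : ℝ) < u := by simpa using hl 0 S.zero_mem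
  rw [← l.integral_comp_comm hint] at hu
  simp only [fun y => hzero _ (hF y), MeasureTheory.integral_zero] at hu
  exact lt_asymm h0 hu

/-! ### Differentiating and mollifying ridge functions -/

section RidgeFunctions

variable {X : Type*} [TopologicalSpace X]

/-- The composition of a function of one variable with a curve `t ↦ t • u + c` of functions is
differentiable in `t`, in the sense of uniform convergence. -/
theorem ContinuousMap.hasDerivAt_comp_smul_add [CompactSpace X] (q q' : C(ℝ, ℝ))
    (hq : ∀ t, HasDerivAt q (q' t) t) (u c : C(X, ℝ)) (t : ℝ) :
    HasDerivAt (fun s : ℝ => q.comp (s • u + c)) (u * q'.comp (t • u + c)) t := by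
  have hcont : Continuous fun s : ℝ => u * q'.comp (s • u + c) :=
    continuous_const.mul ((ContinuousMap.continuous_postcomp q').comp (by fun_prop))
  -- The curve is an integral of its continuous candidate derivative, as is checked pointwise; the
  -- fundamental theorem of calculus in `C(X, ℝ)` then gives uniform convergence.
  have heq : (fun s : ℝ => q.comp (s • u + c)) =
      fun s => q.comp c + ∫ r in (0 : ℝ)..s, u * q'.comp (r • u + c) := by
    funext s
    ext x
    have h1 : (∫ r in (0 : ℝ)..s, u * q'.comp (r • u + c)) x =
        ∫ r in (0 : ℝ)..s, (u * q'.comp (r • u + c)) x :=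
      ((ContinuousMap.evalCLM ℝ x).intervalIntegral_comp_comm
        (hcont.intervalIntegrable 0 s)).symm
    have h2 : ∫ r in (0 : ℝ)..s, (u * q'.comp (r • u + c)) x =
        q (s * u x + c x) - q (0 * u x + c x) := by
      refine intervalIntegral.integral_eq_sub_of_hasDerivAt
        (f := fun r : ℝ => q (r * u x + c x)) (fun r _ => ?_) ?_
      · have := (hq (r * u x + c x)).comp r (((hasDerivAt_id r).mul_const (u x)).add_const (c x))
        simpa [Function.comp_def, mul_comm] using this
      · refine Continuous.intervalIntegrable ?_ 0 s
        exact (ContinuousMap.evalCLM ℝ x).continuous.comp hcont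
    rw [ContinuousMap.add_apply, h1, h2]
    simp
  rw [heq]
  exact ((hcont.integral_hasStrictDerivAt 0 t).hasDerivAt).const_add _

variable {S : Submodule ℝ C(X, ℝ)} {u : C(X, ℝ)}

/-- If a closed subspace contains all `g (t u + b)`, then it contains all
`u ^ k * g⁽ᵏ⁾ (t u + b)`. -/
theorem pow_mul_iteratedDeriv_mem [CompactSpace X] (hS : IsClosed (S : Set C(X, ℝ))) (g : ℝ → ℝ)
    (hg : ContDiff ℝ (⊤ : ℕ∞) g)
    (hmem : ∀ q : C(ℝ, ℝ), ⇑q = g → ∀ t b : ℝ, q.comp (t • u + ContinuousMap.const X b) ∈ S)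
    (k : ℕ) : ∀ q : C(ℝ, ℝ), ⇑q = iteratedDeriv k g →
      ∀ t b : ℝ, u ^ k * q.comp (t • u + ContinuousMap.const X b) ∈ S := by
  induction k with
  | zero => simpa using hmem
  | succ k ih =>
    intro q' hq' t b
    have hd : ∀ s, HasDerivAt (iteratedDeriv k g) (q' s) s := by
      intro s
      rw [hq', iteratedDeriv_succ]
      exact ((hg.differentiable_iteratedDeriv k (by exact_mod_cast ENat.natCast_lt_top k)) s).hasDerivAt
    let q : C(ℝ, ℝ) := ⟨iteratedDeriv k g, hg.continuous_iteratedDeriv k (by exact_mod_cast le_top)⟩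
    have h := (ContinuousMap.hasDerivAt_comp_smul_add q q' hd u
      (ContinuousMap.const X b) t).const_mul (u ^ k)
    have := Submodule.hasDerivAt_mem hS (fun t => ih q rfl t b) h
    rwa [pow_succ, mul_assoc]

/-- A closed subspace that contains all `σ (t u + b)` contains all `(φ ⋆ σ) (t u + b)`. -/
theorem convolution_comp_mem [CompactSpace X] (hS : IsClosed (S : Set C(X, ℝ))) (σ : C(ℝ, ℝ))
    (φ : C(ℝ, ℝ)) (hφ : HasCompactSupport φ)
    (hmem : ∀ t b : ℝ, σ.comp (t • u + ContinuousMap.const X b) ∈ S)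
    (q : C(ℝ, ℝ)) (hq : ⇑q = MeasureTheory.convolution φ σ (ContinuousLinearMap.lsmul ℝ ℝ)
      MeasureTheory.volume) (t b : ℝ) : q.comp (t • u + ContinuousMap.const X b) ∈ S := by
  let F : ℝ → C(X, ℝ) := fun y => φ y • σ.comp (t • u + ContinuousMap.const X (b - y))
  have hF : Continuous F := by
    refine φ.continuous.smul ((ContinuousMap.continuous_postcomp σ).comp
      (continuous_const.add ?_))
    exact ContinuousMap.continuous_const'.comp (continuous_const.sub continuous_id)
  have hint : MeasureTheory.Integrable F :=
    hF.integrable_of_hasCompactSupport hφ.smul_right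
  have : q.comp (t • u + ContinuousMap.const X b) = ∫ y, F y := by
    ext x
    have h1 : (∫ y, F y) x = ∫ y, F y x :=
      ((ContinuousMap.evalCLM ℝ x).integral_comp_comm hint).symm
    rw [h1, ContinuousMap.comp_apply, hq]
    simp [MeasureTheory.convolution, F, add_sub_assoc]
  rw [this]
  exact Submodule.integral_mem_of_forall_mem hS
    (fun y => S.smul_mem _ (hmem t (b - y))) hint

end RidgeFunctions

/-! ### Recognizing polynomials through mollification -/

/-- A smooth function whose `k`-th derivative vanishes is determined by its values at `k` points. -/
theorem eq_lagrange_interpolate_of_iteratedDeriv_eq_zero (k : ℕ) {g : ℝ → ℝ} (hg : ContDiff ℝ (⊤ : ℕ∞) g)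
    (h : ∀ t, iteratedDeriv k g t = 0) (t : ℝ) :
    g t = (Lagrange.interpolate (Finset.range k) (fun i => (i : ℝ)) fun i => g i).eval t := by
  have hpoly : ∀ (k : ℕ) (g : ℝ → ℝ), ContDiff ℝ (⊤ : ℕ∞) g → (∀ t, iteratedDeriv k g t = 0) →
      ∃ p : Polynomial ℝ, p.degree < k ∧ ∀ t, g t = p.eval t := by
    intro k g hg h
    cases k with
    | zero => exact ⟨0, by simp, by simpa using h⟩
    | succ k =>
      -- The Taylor polynomial at `0`; the Lagrange remainder contains the vanishing derivative of
      -- order `k + 1`.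
      refine ⟨∑ i ∈ Finset.range (k + 1),
        Polynomial.C (iteratedDeriv i g 0 / i.factorial) * Polynomial.X ^ i, ?_, fun t => ?_⟩
      · refine (Polynomial.degree_sum_le _ _).trans_lt ?_
        rw [Finset.sup_lt_iff (by exact_mod_cast WithBot.bot_lt_coe (k + 1))]
        intro i hi
        refine (Polynomial.degree_C_mul_X_pow_le _ _).trans_lt ?_
        exact_mod_cast Finset.mem_range.1 hi
      · rcases eq_or_ne t 0 with rfl | ht
        · simp [Polynomial.eval_finsetSum, Finset.sum_range_succ']
        · obtain ⟨_, -, hx⟩ := taylor_mean_remainder_lagrange_iteratedDeriv (n := k) ht.symm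
            (hg.of_le (by exact_mod_cast le_top)).contDiffOn
          rw [h, zero_mul, zero_div, sub_eq_zero, taylor_within_apply] at hx
          rw [hx, Polynomial.eval_finsetSum]
          refine Finset.sum_congr rfl fun i _ => ?_
          rw [iteratedDerivWithin_eq_iteratedDeriv (uniqueDiffOn_uIcc ht.symm)
            (hg.of_le (by exact_mod_cast le_top)).contDiffAt Set.left_mem_uIcc]
          simp
          ring
  obtain ⟨p, hp, hgp⟩ := hpoly k g hg h
  have hinj : Set.InjOn (fun i : ℕ => (i : ℝ)) (Finset.range k : Set ℕ) :=
    fun i _ j _ hij => Nat.cast_injective hij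
  have := Lagrange.eq_interpolate_of_eval_eq (s := Finset.range k) (v := fun i : ℕ => (i : ℝ))
    (fun i : ℕ => g i) hinj (by simpa using hp) (fun i _ => (hgp i).symm)
  rw [← this, hgp]

/-- If the smooth mollifications of a continuous function have vanishing `k`-th derivative,
then the function is polynomial. -/
theorem exists_polynomial_of_iteratedDeriv_convolution_eq_zero (σ : C(ℝ, ℝ)) (k : ℕ)
    (h : ∀ φ : ContDiffBump (0 : ℝ), ∀ t, iteratedDeriv k (MeasureTheory.convolution
      (φ.normed MeasureTheory.volume) σ (ContinuousLinearMap.lsmul ℝ ℝ)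
      MeasureTheory.volume) t = 0) :
    ∃ p : Polynomial ℝ, ∀ t, σ t = p.eval t := by
  let φ : ℕ → ContDiffBump (0 : ℝ) := fun n =>
    ⟨1 / ((n : ℝ) + 1) / 2, 1 / ((n : ℝ) + 1), by positivity, half_lt_self (by positivity)⟩
  have hφ : Filter.Tendsto (fun n => (φ n).rOut) Filter.atTop (nhds 0) :=
    tendsto_one_div_add_atTop_nhds_zero_nat
  have hlim := ContDiffBump.convolution_tendsto_right_of_continuous
    (μ := MeasureTheory.volume) hφ σ.continuous
  -- Interpolants at fixed nodes depend continuously on the nodal values, so equality with the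
  -- interpolant survives the limit of the mollifications.
  refine ⟨Lagrange.interpolate (Finset.range k) (fun i => (i : ℝ)) fun i => σ i, fun t => ?_⟩
  refine tendsto_nhds_unique (hlim t) ?_
  have hsm : ∀ n, ContDiff ℝ (⊤ : ℕ∞) (MeasureTheory.convolution
      ((φ n).normed MeasureTheory.volume) σ (ContinuousLinearMap.lsmul ℝ ℝ)
      MeasureTheory.volume) := fun n =>
    (φ n).hasCompactSupport_normed.contDiff_convolution_left _ (φ n).contDiff_normed
      σ.continuous.locallyIntegrable
  rw [show (fun n => MeasureTheory.convolution
      ((φ n).normed MeasureTheory.volume) σ (ContinuousLinearMap.lsmul ℝ ℝ)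
      MeasureTheory.volume t) = _ from funext fun n =>
    eq_lagrange_interpolate_of_iteratedDeriv_eq_zero k (hsm n) (h (φ n)) t]
  simp only [Lagrange.interpolate_apply, Polynomial.eval_finsetSum, Polynomial.eval_mul,
    Polynomial.eval_C]
  exact tendsto_finsetSum _ fun i _ => (hlim i).mul_const _

/-! ### Density of ridge functions -/

/-- A closed subspace that contains all `σ (t u + b)`, with `σ` not a polynomial, contains the powers
of `u`. -/
theorem pow_mem_of_not_polynomial {X : Type*} [TopologicalSpace X] [CompactSpace X]
    {S : Submodule ℝ C(X, ℝ)} (hS : IsClosed (S : Set C(X, ℝ))) (σ : C(ℝ, ℝ))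
    (hσ : ¬ ∃ p : Polynomial ℝ, ∀ t, σ t = p.eval t) {u : C(X, ℝ)}
    (hmem : ∀ t b : ℝ, σ.comp (t • u + ContinuousMap.const X b) ∈ S) (k : ℕ) : u ^ k ∈ S := by
  by_contra hk
  refine hσ (exists_polynomial_of_iteratedDeriv_convolution_eq_zero σ k fun φ b => ?_)
  by_contra hne
  refine hk ?_
  set g := MeasureTheory.convolution (φ.normed MeasureTheory.volume) σ
    (ContinuousLinearMap.lsmul ℝ ℝ) MeasureTheory.volume with hgdef
  have hg : ContDiff ℝ (⊤ : ℕ∞) g := φ.hasCompactSupport_normed.contDiff_convolution_left _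
    φ.contDiff_normed σ.continuous.locallyIntegrable
  -- At `t = 0` the second factor is the nonzero constant `iteratedDeriv k g b`, which can be
  -- divided out.
  have h := pow_mul_iteratedDeriv_mem (u := u) hS g hg
    (fun q hq => convolution_comp_mem hS σ ⟨_, φ.continuous_normed⟩ φ.hasCompactSupport_normed
      hmem q hq) k ⟨_, hg.continuous_iteratedDeriv k (by exact_mod_cast le_top)⟩ rfl 0 b
  have := S.smul_mem (iteratedDeriv k g b)⁻¹ h
  convert this using 1
  ext x
  simp
  field_simp

/-- **Density of ridge functions.** If `V` is a space of continuous functions that separates the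
points of a compact space and `σ` is continuous and not a polynomial, then
the functions `σ (v + b)`, `v ∈ V`, span a dense subspace. -/
theorem topologicalClosure_span_ridge_eq_top {X : Type*} [TopologicalSpace X] [CompactSpace X]
    (σ : C(ℝ, ℝ)) (hσ : ¬ ∃ p : Polynomial ℝ, ∀ t, σ t = p.eval t) (V : Submodule ℝ C(X, ℝ))
    (hV : ∀ x y, x ≠ y → ∃ v ∈ V, v x ≠ v y) :
    (Submodule.span ℝ {g | ∃ v ∈ V, ∃ b : ℝ,
      g = σ.comp (v + ContinuousMap.const X b)}).topologicalClosure = ⊤ := by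
  set R := Submodule.span ℝ {g | ∃ v ∈ V, ∃ b : ℝ, g = σ.comp (v + ContinuousMap.const X b)}
  have hS : IsClosed (R.topologicalClosure : Set C(X, ℝ)) := R.isClosed_topologicalClosure
  have hpow : ∀ v ∈ V, ∀ k : ℕ, v ^ k ∈ R.topologicalClosure := fun v hv =>
    pow_mem_of_not_polynomial hS σ hσ fun t b => R.le_topologicalClosure
      (Submodule.subset_span ⟨t • v, V.smul_mem t hv, b, rfl⟩)
  have hexp : ∀ v ∈ V, NormedSpace.exp v ∈ R.topologicalClosure := fun v hv =>
    hS.mem_of_tendsto (NormedSpace.exp_series_hasSum_exp' (𝕂 := ℝ) v)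
      (Filter.Eventually.of_forall fun s => Submodule.sum_mem _ fun k _ =>
        Submodule.smul_mem _ _ (hpow v hv k))
  have hball : ∀ v : C(X, ℝ),
      v ∈ Metric.eball (0 : C(X, ℝ)) (NormedSpace.expSeries ℝ C(X, ℝ)).radius := fun v => by
    rw [NormedSpace.expSeries_radius_eq_top]
    exact edist_lt_top _ _
  have exp_add : ∀ v w : C(X, ℝ),
      NormedSpace.exp (v + w) = NormedSpace.exp v * NormedSpace.exp w := fun v w =>
    NormedSpace.exp_add_of_mem_ball (hball v) (hball w)
  let E : Submonoid C(X, ℝ) :=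
    { carrier := {g | ∃ v ∈ V, g = NormedSpace.exp v}
      one_mem' := ⟨0, V.zero_mem, by simp⟩
      mul_mem' := by
        rintro _ _ ⟨v, hv, rfl⟩ ⟨w, hw, rfl⟩
        exact ⟨v + w, V.add_mem hv hw, (exp_add v w).symm⟩ }
  let A : Subalgebra ℝ C(X, ℝ) := Algebra.adjoin ℝ (E : Set C(X, ℝ))
  have hA : (A : Set C(X, ℝ)) ⊆ R.topologicalClosure := by
    have : Subalgebra.toSubmodule A ≤ R.topologicalClosure := by
      -- The exponentials are closed under products, so the algebra they generate is their linear
      -- span.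
      rw [Algebra.adjoin_eq_span, Submonoid.closure_eq, Submodule.span_le]
      rintro _ ⟨v, hv, rfl⟩
      exact hexp v hv
    exact this
  have hsep : A.SeparatesPoints := by
    intro x y hxy
    obtain ⟨v, hv, hne⟩ := hV x y hxy
    refine ⟨_, ⟨NormedSpace.exp v, Algebra.subset_adjoin ⟨v, hv, rfl⟩, rfl⟩, ?_⟩
    have heval : ∀ z, NormedSpace.exp v z = Real.exp (v z) := fun z => by
      rw [Real.exp_eq_exp_ℝ]
      exact NormedSpace.map_exp_of_mem_ball (𝕂 := ℝ) (ContinuousMap.evalAlgHom ℝ ℝ z)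
        (ContinuousMap.evalCLM ℝ z).continuous v (hball v)
    change NormedSpace.exp v x ≠ NormedSpace.exp v y
    rw [heval, heval]
    exact fun h => hne (Real.exp_injective h)
  refine eq_top_iff.2 fun g _ => ?_
  have hg : g ∈ A.topologicalClosure := by
    rw [ContinuousMap.subalgebra_topologicalClosure_eq_top_of_separatesPoints A hsep]
    trivial
  exact closure_minimal hA hS hg

/-- Density of ridge functions, for a space of functions that need not separate points. -/
theorem mem_topologicalClosure_span_ridge {X : Type*} [TopologicalSpace X] [CompactSpace X]
    (σ : C(ℝ, ℝ)) (hσ : ¬ ∃ p : Polynomial ℝ, ∀ t, σ t = p.eval t) (V : Submodule ℝ C(X, ℝ))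
    (f : C(X, ℝ)) (hf : ∀ x y, (∀ v ∈ V, v x = v y) → f x = f y) :
    f ∈ (Submodule.span ℝ {g | ∃ v ∈ V, ∃ b : ℝ,
      g = σ.comp (v + ContinuousMap.const X b)}).topologicalClosure := by
  -- On the quotient by this relation `V` separates points, and composition with `π` carries ridge
  -- functions to ridge functions.
  let r : Setoid X := ⟨fun x y => ∀ v ∈ V, v x = v y, fun _ _ _ => rfl,
    fun h v hv => (h v hv).symm, fun h h' v hv => (h v hv).trans (h' v hv)⟩
  let π : C(X, Quotient r) := ⟨Quotient.mk r, continuous_quotient_mk'⟩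
  let P : C(Quotient r, ℝ) →L[ℝ] C(X, ℝ) :=
    { toFun := fun g => g.comp π
      map_add' := fun _ _ => rfl
      map_smul' := fun _ _ => rfl
      cont := ContinuousMap.continuous_precomp π }
  let lift (v : C(X, ℝ)) (hv : ∀ x y, r x y → v x = v y) : C(Quotient r, ℝ) :=
    ⟨Quotient.lift v hv, v.continuous.quotient_lift hv⟩
  have hP : ∀ v hv, P (lift v hv) = v := fun v hv => rfl
  have htop := topologicalClosure_span_ridge_eq_top σ hσ (V.comap P.toLinearMap) (by
    intro x y
    induction x, y using Quotient.inductionOn₂ with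
    | _ x y =>
      intro hxy
      have : ¬ ∀ v ∈ V, v x = v y := fun h => hxy (Quotient.sound h)
      push Not at this
      obtain ⟨v, hv, hne⟩ := this
      exact ⟨lift v fun _ _ h => h v hv, hv, hne⟩)
  have hmem : lift f hf ∈ (Submodule.span ℝ {g | ∃ v ∈ V.comap P.toLinearMap, ∃ b : ℝ,
      g = σ.comp (v + ContinuousMap.const (Quotient r) b)}).topologicalClosure :=
    htop ▸ Submodule.mem_top
  rw [← hP f hf]
  refine map_mem_closure P.continuous hmem fun g hg => ?_
  have hle : Submodule.span ℝ {g | ∃ v ∈ V.comap P.toLinearMap, ∃ b : ℝ,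
      g = σ.comp (v + ContinuousMap.const (Quotient r) b)} ≤ (Submodule.span ℝ {g | ∃ v ∈ V,
      ∃ b : ℝ, g = σ.comp (v + ContinuousMap.const X b)}).comap P.toLinearMap := by
    rw [Submodule.span_le]
    rintro _ ⟨v, hv, b, rfl⟩
    exact Submodule.subset_span ⟨P v, hv, b, rfl⟩
  exact hle hg

/-! ### Features of equivariant networks -/

/-- Finitely many vectors in a span are combinations of finitely many generators. -/
theorem Submodule.exists_fin_generators_of_forall_mem_span {E : Type*} [AddCommGroup E]
    [Module ℝ E] {T : Set E} {ι : Type*} [Finite ι] (u : ι → E)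
    (hu : ∀ c, u c ∈ Submodule.span ℝ T) :
    ∃ (m : ℕ) (t : Fin m → E) (C : ι → Fin m → ℝ), (∀ j, t j ∈ T) ∧
      ∀ c, u c = ∑ j, C c j • t j := by
  classical
  cases nonempty_fintype ι
  choose T' hT' hu' using fun c => Submodule.mem_span_finite_of_mem_span (hu c)
  let U : Finset E := Finset.univ.biUnion T'
  let t : Fin U.card → E := fun j => (U.equivFin.symm j : E)
  have hrange : Set.range t = U := by
    change Set.range ((Subtype.val : U → E) ∘ U.equivFin.symm) = U
    rw [U.equivFin.symm.surjective.range_comp]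
    simp
  have hspan : ∀ c, ∃ C : Fin U.card → ℝ, ∑ j, C j • t j = u c := fun c => by
    rw [← Submodule.mem_span_range_iff_exists_fun, hrange]
    refine Submodule.span_mono ?_ (hu' c)
    exact_mod_cast Finset.subset_biUnion_of_mem T' (Finset.mem_univ c)
  choose C hC using hspan
  refine ⟨_, t, C, fun j => ?_, fun c => (hC c).symm⟩
  obtain ⟨c, -, hc⟩ := Finset.mem_biUnion.1 (U.equivFin.symm j).2
  exact hT' c hc

/-- The translate of an image. -/
def shiftImage {d : ℕ} (g : Pixel d) (x : Pixel d → ℝ) : Pixel d → ℝ := fun q => x (q + g)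

theorem shiftImage_shiftImage {d : ℕ} (g g' : Pixel d) (x : Pixel d → ℝ) :
    shiftImage g (shiftImage g' x) = shiftImage (g + g') x := by
  funext q
  simp [shiftImage, add_assoc]

theorem shiftImage_zero {d : ℕ} (x : Pixel d → ℝ) : shiftImage 0 x = x := by
  funext q
  simp [shiftImage]

theorem continuous_shiftImage {d : ℕ} (g : Pixel d) : Continuous (shiftImage g) :=
  continuous_pi fun q => continuous_apply (q + g)

/-- The contributions of biases to the entries of a layer. -/
def biasSpace (E : Type*) (κ : LayerKind) : Submodule ℝ (E → ℝ) where
  carrier := {w | ∃ b : ℝ, (κ = LayerKind.linear → b = 0) ∧ w = fun _ => b}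
  zero_mem' := ⟨0, fun _ => rfl, rfl⟩
  add_mem' := by
    rintro _ _ ⟨b, hb, rfl⟩ ⟨b', hb', rfl⟩
    exact ⟨b + b', fun h => by rw [hb h, hb' h, add_zero], rfl⟩
  smul_mem' := by
    rintro r _ ⟨b, hb, rfl⟩
    exact ⟨r * b, fun h => by rw [hb h, mul_zero], rfl⟩

/-- The real functions of an image that occur, at a fixed pixel, in the output of an
equivariant network with `n` activation layers and with tensors of order one. -/
def featureSpace (d : ℕ) (κ : LayerKind) (σ : ℝ → ℝ) :
    ℕ → Submodule ℝ ((Pixel d → ℝ) → ℝ)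
  | 0 => Submodule.span ℝ (Set.range fun (q : Pixel d) x => x q) ⊔ biasSpace _ κ
  | n + 1 => Submodule.span ℝ {w | ∃ u ∈ featureSpace d κ σ n, ∃ g : Pixel d,
      w = fun x => σ (u (shiftImage g x))} ⊔ biasSpace _ κ

section

variable {d : ℕ} {κ : LayerKind} {σ : ℝ → ℝ}

theorem activate_mem_featureSpace {n : ℕ} {u : (Pixel d → ℝ) → ℝ}
    (hu : u ∈ featureSpace d κ σ n) : (fun x => σ (u x)) ∈ featureSpace d κ σ (n + 1) :=
  Submodule.mem_sup_left (Submodule.subset_span ⟨u, hu, 0, by simp only [shiftImage_zero]⟩)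

theorem apply_mem_featureSpace_zero (q : Pixel d) :
    (fun x : Pixel d → ℝ => x q) ∈ featureSpace d κ σ 0 :=
  Submodule.mem_sup_left (Submodule.subset_span ⟨q, rfl⟩)

theorem continuous_of_mem_featureSpace (hσ : Continuous σ) {n : ℕ} :
    ∀ {u : (Pixel d → ℝ) → ℝ}, u ∈ featureSpace d κ σ n → Continuous u := by
  let W : Submodule ℝ ((Pixel d → ℝ) → ℝ) :=
    { carrier := {u | Continuous u}
      zero_mem' := continuous_const
      add_mem' := fun {u v} (h : Continuous u) (h' : Continuous v) => h.add h'
      smul_mem' := fun r u (h : Continuous u) => h.const_smul r }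
  have hbias : biasSpace _ κ ≤ W := by
    rintro _ ⟨b, -, rfl⟩
    exact (continuous_const : Continuous fun _ : Pixel d → ℝ => b)
  suffices h : featureSpace d κ σ n ≤ W from fun {u} hu => h hu
  induction n with
  | zero =>
    refine sup_le (Submodule.span_le.2 ?_) hbias
    rintro _ ⟨q, rfl⟩
    exact continuous_apply q
  | succ n ih =>
    refine sup_le (Submodule.span_le.2 ?_) hbias
    rintro _ ⟨u, hu, g, rfl⟩
    exact hσ.comp ((ih hu : Continuous u).comp (continuous_shiftImage g))

/-- A translation equivariant layer between tensors of order one: the entry of the output at a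
pixel is a combination of entries of the input at translates of this pixel. -/
theorem isEquivariantLayer_convolution {a b m : ℕ} (C : Fin b → Fin m → ℝ) (s : Fin m → Pixel d)
    (r : Fin m → Fin a) (β : Fin b → ℝ) (hβ : κ = LayerKind.linear → β = 0) :
    IsEquivariantLayer (translations d) κ (k := 1) (l := 1)
      (fun X i c => ∑ j, C c j * X (fun _ => s j + i 0) (r j) + β c) := by
  refine ⟨
    { toFun := fun X i c => ∑ j, C c j * X (fun _ => s j + i 0) (r j)
      map_add' := fun X Y => ?_
      map_smul' := fun t X => ?_ }, fun _ c => β c, ?_, ?_, ?_, fun X => rfl⟩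
  · funext i c
    simp [mul_add, Finset.sum_add_distrib]
  · funext i c
    simp only [Pi.smul_apply, smul_eq_mul, RingHom.id_apply, Finset.mul_sum]
    exact Finset.sum_congr rfl fun j _ => by ring
  · rintro _ ⟨g, rfl⟩ X
    funext i c
    simp [permTensor, add_assoc]
  · rintro _ ⟨g, rfl⟩
    rfl
  · intro h
    funext i c
    simp [hβ h]

/-- Finitely many features are computed by a common equivariant stack. -/
theorem exists_isEquivariantStack_of_mem_featureSpace {N : ℕ} (hN : 1 ≤ N) (n : ℕ) :
    ∀ {a : ℕ} (u : Fin a → (Pixel d → ℝ) → ℝ), (∀ c, u c ∈ featureSpace d κ σ n) →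
      ∃ Φ : Tensor (Pixel d) 1 1 → Tensor (Pixel d) 1 a,
        IsEquivariantStack (translations d) κ σ N Φ ∧
        ∀ x i c, Φ (inputTensor x) i c = u c (shiftImage (i 0) x) := by
  have hsplit : ∀ {T : Set ((Pixel d → ℝ) → ℝ)} {a : ℕ} (u : Fin a → (Pixel d → ℝ) → ℝ),
      (∀ c, u c ∈ Submodule.span ℝ T ⊔ biasSpace _ κ) →
      ∃ (m : ℕ) (t : Fin m → (Pixel d → ℝ) → ℝ) (C : Fin a → Fin m → ℝ) (β : Fin a → ℝ),
        (∀ j, t j ∈ T) ∧ (κ = LayerKind.linear → β = 0) ∧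
        ∀ c x, u c x = ∑ j, C c j * t j x + β c := by
    intro T a u hu
    choose w hw v hv huv using fun c => Submodule.mem_sup.1 (hu c)
    choose β hβ hβv using hv
    obtain ⟨m, t, C, ht, hC⟩ := Submodule.exists_fin_generators_of_forall_mem_span w hw
    refine ⟨m, t, C, β, ht, fun h => funext fun c => hβ c h, fun c x => ?_⟩
    rw [← huv c, hβv c, hC c]
    simp
  induction n with
  | zero =>
    intro a u hu
    obtain ⟨m, t, C, β, ht, hβ, hC⟩ := hsplit u hu
    choose s hs using ht
    refine ⟨_, .first _ hN hN (isEquivariantLayer_convolution C s (fun _ => 0) β hβ),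
      fun x i c => ?_⟩
    simp [hC, ← hs, inputTensor, shiftImage]
  | succ n ih =>
    intro a u hu
    obtain ⟨m, t, C, β, ht, hβ, hC⟩ := hsplit u hu
    choose v hv s hs using ht
    obtain ⟨Φ, hΦ, hΦv⟩ := ih v hv
    -- One hidden channel per generator (hence `id`); the shift in each generator becomes the offset
    -- of the convolution.
    refine ⟨_, .next Φ _ hΦ hN (isEquivariantLayer_convolution C s id β hβ), fun x i c => ?_⟩
    simp [hC, hs, activate, hΦv, shiftImage_shiftImage]

/-! ### Invariant networks and separation of orbits -/

variable [NeZero d]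

/-- Summing the translates of a feature gives an invariant function. -/
def sumTranslates (u : (Pixel d → ℝ) → ℝ) (x : Pixel d → ℝ) : ℝ := ∑ p, u (shiftImage p x)

/-- A perceptron with one hidden layer, applied to sums of translates of features, is an
invariant network. -/
theorem isInvariantNetwork_sum_activate_sumTranslates {N : ℕ} (hN : 1 ≤ N) {n m : ℕ}
    (u : Fin m → (Pixel d → ℝ) → ℝ) (hu : ∀ c, u c ∈ featureSpace d κ σ n) (b C : Fin m → ℝ) :
    IsInvariantNetwork (translations d) κ σ N
      (fun x => ∑ j, C j * σ (sumTranslates (u j) x + b j)) := by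
  obtain ⟨Φ, hΦ, hΦu⟩ := exists_isEquivariantStack_of_mem_featureSpace hN n u hu
  refine ⟨1, m, m, Φ,
    { toFun := fun X c => ∑ p : Pixel d, X (fun _ => p) c
      map_add' := fun X Y => funext fun c => by simp [Finset.sum_add_distrib]
      map_smul' := fun t X => funext fun c => by simp [Finset.mul_sum] }, _, hΦ, ?_,
    -- The invariant layer already produces the sums, so the first affine map only adds `b`.
    .next _ (.affine 1 b) (Matrix.of fun _ j => C j) 0, fun x => ?_⟩
  · rintro _ ⟨g, rfl⟩ X
    funext c
    exact Equiv.sum_comp (Equiv.addRight g) fun p => X (fun _ => p) c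
  · simp [Matrix.mulVec, dotProduct, hΦu, sumTranslates]

/-- If the sums of translates of features separate the orbits of the translations, then the
invariant networks are dense in the continuous invariant functions. -/
theorem exists_isInvariantNetwork_of_separates_orbits {N : ℕ} (hN : 1 ≤ N) (n : ℕ)
    (hσ : Continuous σ) (hσp : ¬ ∃ p : Polynomial ℝ, ∀ t, σ t = p.eval t)
    (hsep : ∀ x y : Pixel d → ℝ, (∀ g, shiftImage g x ≠ y) →
      ∃ u ∈ featureSpace d κ σ n, sumTranslates u x ≠ sumTranslates u y)
    (f : (Pixel d → ℝ) → ℝ) (hf : Continuous f) (hinv : ∀ g x, f (shiftImage g x) = f x)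
    (K : Set (Pixel d → ℝ)) (hK : IsCompact K) (ε : ℝ) (hε : 0 < ε) :
    ∃ F : (Pixel d → ℝ) → ℝ, IsInvariantNetwork (translations d) κ σ N F ∧
      ∀ x ∈ K, |F x - f x| < ε := by
  have : CompactSpace K := isCompact_iff_compactSpace.1 hK
  let V : Submodule ℝ C(K, ℝ) :=
    { carrier := {v | ∃ u ∈ featureSpace d κ σ n, ∀ x : K, v x = sumTranslates u x}
      zero_mem' := ⟨0, Submodule.zero_mem _, fun x => by simp [sumTranslates]⟩
      add_mem' := by
        rintro _ _ ⟨u, hu, hv⟩ ⟨u', hu', hv'⟩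
        exact ⟨u + u', Submodule.add_mem _ hu hu', fun x => by
          simp [hv, hv', sumTranslates, Finset.sum_add_distrib]⟩
      smul_mem' := by
        rintro t _ ⟨u, hu, hv⟩
        exact ⟨t • u, Submodule.smul_mem _ t hu, fun x => by
          simp [hv, sumTranslates, Finset.mul_sum]⟩ }
  let f' : C(K, ℝ) := ⟨fun x => f x, hf.comp continuous_subtype_val⟩
  have hmem := mem_topologicalClosure_span_ridge ⟨σ, hσ⟩ hσp V f' (by
    intro x y hxy
    by_contra hne
    obtain ⟨u, hu, huxy⟩ := hsep x y fun g hg => hne (by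
      change f x = f y
      rw [← hg, hinv])
    refine huxy (hxy ⟨fun x => sumTranslates u x, ?_⟩ ⟨u, hu, fun _ => rfl⟩)
    exact continuous_finsetSum _ fun p _ => (continuous_of_mem_featureSpace hσ hu).comp
      ((continuous_shiftImage p).comp continuous_subtype_val))
  obtain ⟨r, hr, hrf⟩ := Metric.mem_closure_iff.1 hmem ε hε
  obtain ⟨m, t, C, ht, hC⟩ := Submodule.exists_fin_generators_of_forall_mem_span
    (fun _ : Unit => r) fun _ => hr
  choose v hv b hb using ht
  choose u hu huv using hv
  refine ⟨_, isInvariantNetwork_sum_activate_sumTranslates hN u hu b (C ()), fun x hx => ?_⟩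
  have hrx : r ⟨x, hx⟩ = ∑ j, C () j * σ (sumTranslates (u j) x + b j) := by
    rw [hC ()]
    simp [ContinuousMap.sum_apply, hb, huv]
  rw [← hrx, ← Real.dist_eq, dist_comm]
  exact (ContinuousMap.dist_apply_le_dist ⟨x, hx⟩).trans_lt hrf

/-- If the features with `n` activation layers separate points, and the next layer contains the
activations of their sums with constants, then the next layer separates orbits. -/
theorem exists_sumTranslates_ne_of_separates_points (n : ℕ)
    (hσ : Continuous σ) (hσp : ¬ ∃ p : Polynomial ℝ, ∀ t, σ t = p.eval t)
    (hsep : ∀ x y : Pixel d → ℝ, x ≠ y → ∃ u ∈ featureSpace d κ σ n, u x ≠ u y)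
    (hridge : ∀ u ∈ featureSpace d κ σ n, ∀ b : ℝ,
      (fun x => σ (u x + b)) ∈ featureSpace d κ σ (n + 1))
    (x y : Pixel d → ℝ) (hxy : ∀ g, shiftImage g x ≠ y) :
    ∃ u ∈ featureSpace d κ σ (n + 1), sumTranslates u x ≠ sumTranslates u y := by
  classical
  let Z : Set (Pixel d → ℝ) :=
    Set.range (fun g => shiftImage g x) ∪ Set.range fun g => shiftImage g y
  have : Finite Z := ((Set.finite_range _).union (Set.finite_range _)).to_subtype
  let res : ((Pixel d → ℝ) → ℝ) →ₗ[ℝ] C(Z, ℝ) :=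
    { toFun := fun u => ⟨fun z => u z, continuous_of_discreteTopology⟩
      map_add' := fun _ _ => rfl
      map_smul' := fun _ _ => rfl }
  have htop := topologicalClosure_span_ridge_eq_top ⟨σ, hσ⟩ hσp ((featureSpace d κ σ n).map res) (by
    intro z w hzw
    obtain ⟨u, hu, hne⟩ := hsep z w (Subtype.coe_injective.ne hzw)
    exact ⟨res u, ⟨u, hu, rfl⟩, hne⟩)
  -- The indicator of the orbit of `x`. An approximation within `1 / 2` exceeds `1 / 2` on that
  -- orbit and stays below it on the orbit of `y`, so the sums compare term by term.
  let f : C(Z, ℝ) := ⟨fun z => if ∃ g, shiftImage g x = z then 1 else 0,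
    continuous_of_discreteTopology⟩
  have hf := htop ▸ (Submodule.mem_top : f ∈ (⊤ : Submodule ℝ C(Z, ℝ)))
  obtain ⟨r, hr, hrf⟩ := Metric.mem_closure_iff.1 hf (1 / 2) one_half_pos
  have hle : Submodule.span ℝ {g | ∃ v ∈ (featureSpace d κ σ n).map res, ∃ b : ℝ,
      g = ContinuousMap.comp ⟨σ, hσ⟩ (v + ContinuousMap.const Z b)} ≤
      (featureSpace d κ σ (n + 1)).map res := by
    rw [Submodule.span_le]
    rintro _ ⟨_, ⟨u, hu, rfl⟩, b, rfl⟩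
    exact ⟨_, hridge u hu b, rfl⟩
  obtain ⟨u, hu, rfl⟩ := hle hr
  have hclose : ∀ z : Z, |f z - u z| < 1 / 2 := fun z =>
    (ContinuousMap.dist_apply_le_dist z).trans_lt hrf
  refine ⟨u, hu, ne_of_gt ?_⟩
  refine Finset.sum_lt_sum_of_nonempty Finset.univ_nonempty fun p _ => ?_
  have hx := hclose ⟨shiftImage p x, Or.inl ⟨p, rfl⟩⟩
  have hy := hclose ⟨shiftImage p y, Or.inr ⟨p, rfl⟩⟩
  have hfx : f ⟨shiftImage p x, Or.inl ⟨p, rfl⟩⟩ = 1 := if_pos ⟨p, rfl⟩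
  have hfy : f ⟨shiftImage p y, Or.inr ⟨p, rfl⟩⟩ = 0 := by
    refine if_neg ?_
    rintro ⟨g, hg⟩
    refine hxy (-p + g) ?_
    rw [← shiftImage_shiftImage, hg, shiftImage_shiftImage, neg_add_cancel, shiftImage_zero]
  rw [hfx] at hx
  rw [hfy] at hy
  rw [abs_lt] at hx hy
  linarith [hx.2, hy.1]

end

/-! ### The logistic sigmoid -/

section Sigmoid

theorem Real.not_polynomial_sigmoid : ¬ ∃ p : Polynomial ℝ, ∀ t, Real.sigmoid t = p.eval t := by
  rintro ⟨p, hp⟩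
  -- A polynomial bounded at infinity is constant, whereas the sigmoid is injective.
  have hdeg : p.degree ≤ 0 := by
    rw [← Polynomial.isBoundedUnder_abs_atTop_iff]
    refine Filter.isBoundedUnder_of ⟨1, fun t => ?_⟩
    rw [← hp, abs_of_nonneg (Real.sigmoid_nonneg t)]
    exact Real.sigmoid_le_one t
  have h01 : Real.sigmoid 0 = Real.sigmoid 1 := by
    rw [hp, hp, Polynomial.eq_C_of_degree_le_zero hdeg]
    simp
  exact zero_ne_one (Real.sigmoid_injective h01)

variable {d : ℕ} {κ : LayerKind}

/-- Since `σ 0 = 1/2`, activating the zero feature replaces a bias. -/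
theorem const_mem_featureSpace_sigmoid_one (b : ℝ) :
    (fun _ => b) ∈ featureSpace d κ Real.sigmoid 1 := by
  have h := (featureSpace d κ Real.sigmoid 1).smul_mem (2 * b)
    (activate_mem_featureSpace (Submodule.zero_mem (featureSpace d κ Real.sigmoid 0)))
  convert h using 1
  funext x
  simp [Real.sigmoid_zero, mul_comm 2 b]

end Sigmoid

/-! ### The rectified linear unit -/

section ReLU

theorem continuous_relu : Continuous relu := continuous_id.max continuous_const

theorem not_polynomial_relu : ¬ ∃ p : Polynomial ℝ, ∀ t, relu t = p.eval t := by
  rintro ⟨p, hp⟩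
  have hp0 : p = 0 := by
    refine Polynomial.eq_zero_of_infinite_isRoot p ((Set.Iio_infinite (0 : ℝ)).mono fun t ht => ?_)
    rw [Set.mem_ofPred_eq, Polynomial.IsRoot, ← hp]
    exact max_eq_right (le_of_lt ht)
  have := hp 1
  simp [hp0, relu] at this

theorem relu_add_relu_neg (t : ℝ) : relu t + relu (-t) = |t| := by
  rcases le_total 0 t with h | h <;> simp [relu, h, abs_of_nonneg, abs_of_nonpos]

theorem relu_sub_relu_neg (t : ℝ) : relu t - relu (-t) = t := by
  rcases le_total 0 t with h | h <;> simp [relu, h]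

variable {d : ℕ} {κ : LayerKind}

/-- Two ReLUs reproduce the identity, so features of different depths can be combined. -/
theorem mem_featureSpace_relu_succ {n : ℕ} {u : (Pixel d → ℝ) → ℝ}
    (hu : u ∈ featureSpace d κ relu n) : u ∈ featureSpace d κ relu (n + 1) := by
  have := Submodule.sub_mem _ (activate_mem_featureSpace hu)
    (activate_mem_featureSpace (Submodule.neg_mem _ hu))
  convert this using 1
  funext x
  exact (relu_sub_relu_neg (u x)).symm

theorem abs_mem_featureSpace_relu_succ {n : ℕ} {u : (Pixel d → ℝ) → ℝ}
    (hu : u ∈ featureSpace d κ relu n) : (fun x => |u x|) ∈ featureSpace d κ relu (n + 1) := by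
  have := Submodule.add_mem _ (activate_mem_featureSpace hu)
    (activate_mem_featureSpace (Submodule.neg_mem _ hu))
  convert this using 1
  funext x
  exact (relu_add_relu_neg (u x)).symm

variable [NeZero d]

/-- The sum of the absolute values of the entries of an image. -/
def imageNorm (x : Pixel d → ℝ) : ℝ := ∑ q, |x q|

theorem imageNorm_nonneg (x : Pixel d → ℝ) : 0 ≤ imageNorm x :=
  Finset.sum_nonneg fun _ _ => abs_nonneg _

theorem imageNorm_eq_zero {x : Pixel d → ℝ} : imageNorm x = 0 ↔ x = 0 := by
  rw [imageNorm, Finset.sum_eq_zero_iff_of_nonneg fun _ _ => abs_nonneg _]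
  simp [funext_iff]

theorem imageNorm_shiftImage (g : Pixel d) (x : Pixel d → ℝ) :
    imageNorm (shiftImage g x) = imageNorm x :=
  Equiv.sum_comp (Equiv.addRight g) fun q => |x q|

theorem imageNorm_mem_featureSpace_relu : imageNorm ∈ featureSpace d κ relu 1 := by
  have := Submodule.sum_mem (featureSpace d κ relu 1) (t := Finset.univ) fun (q : Pixel d) _ =>
    abs_mem_featureSpace_relu_succ (apply_mem_featureSpace_zero q)
  convert this using 1
  funext x
  simp [imageNorm]

/-- The features of ReLU networks with three activation layers separate orbits. -/
theorem exists_sumTranslates_ne_relu (x y : Pixel d → ℝ) (hxy : ∀ g, shiftImage g x ≠ y) :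
    ∃ u ∈ featureSpace d κ relu 3, sumTranslates u x ≠ sumTranslates u y := by
  have hN2 : imageNorm ∈ featureSpace d κ relu 2 :=
    mem_featureSpace_relu_succ imageNorm_mem_featureSpace_relu
  by_cases hnorm : imageNorm x = imageNorm y
  swap
  · refine ⟨imageNorm, mem_featureSpace_relu_succ hN2, ?_⟩
    simpa [sumTranslates, imageNorm_shiftImage] using ⟨hnorm, NeZero.ne d⟩
  set c := imageNorm x with hc
  have hc0 : 0 < c := by
    refine (imageNorm_nonneg x).lt_of_ne' fun h0 => hxy 0 ?_
    rw [shiftImage_zero, imageNorm_eq_zero.1 h0, imageNorm_eq_zero.1 (hnorm.symm.trans h0)]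
  -- A homogeneous version of the distance to `x`: on images of norm `c` it equals `c` times the
  -- `ℓ¹` distance to `x`.
  let e : (Pixel d → ℝ) → ℝ := fun z => imageNorm fun q => c * z q - x q * imageNorm z
  have he : e ∈ featureSpace d κ relu 2 := by
    have := Submodule.sum_mem (featureSpace d κ relu 2) (t := Finset.univ) fun (q : Pixel d) _ =>
      abs_mem_featureSpace_relu_succ (Submodule.sub_mem _
        (Submodule.smul_mem _ c (mem_featureSpace_relu_succ (apply_mem_featureSpace_zero q)))
        (Submodule.smul_mem _ (x q) imageNorm_mem_featureSpace_relu))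
    convert this using 1
    funext z
    simp [e, imageNorm]
  obtain ⟨p₀, hp₀⟩ := Finite.exists_min fun p : Pixel d => e (shiftImage p y)
  set δ := e (shiftImage p₀ y) with hδ
  have hδ0 : 0 < δ := by
    -- If `e` vanished at a translate of `y`, that translate, having norm `c`, would be `x`.
    refine (imageNorm_nonneg _).lt_of_ne' fun h0 => hxy (-p₀) ?_
    have h1 := imageNorm_eq_zero.1 h0
    have h2 : x = shiftImage p₀ y := by
      funext q
      have h3 := congrFun h1 q
      rw [imageNorm_shiftImage, ← hnorm, mul_comm, ← sub_mul] at h3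
      rcases mul_eq_zero.1 h3 with h4 | h4
      · exact (sub_eq_zero.1 h4).symm
      · exact absurd h4 hc0.ne'
    rw [h2, shiftImage_shiftImage, neg_add_cancel, shiftImage_zero]
  -- On images of norm `c` this is `relu (δ - e z)`, a bump around `x`: it is `δ` at `x` and zero on
  -- the orbit of `y`, where `e ≥ δ`.
  refine ⟨fun z => relu ((δ / c) * imageNorm z - e z), activate_mem_featureSpace
    (Submodule.sub_mem _ (Submodule.smul_mem _ (δ / c) hN2) he), ne_of_gt ?_⟩
  have hy : sumTranslates (fun z => relu ((δ / c) * imageNorm z - e z)) y = 0 := by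
    refine Finset.sum_eq_zero fun p _ => max_eq_right ?_
    rw [imageNorm_shiftImage, ← hnorm, div_mul_cancel₀ _ hc0.ne']
    exact sub_nonpos.2 (hp₀ p)
  rw [hy]
  refine Finset.sum_pos' (fun p _ => le_max_right _ _) ⟨0, Finset.mem_univ _, ?_⟩
  have hex : e x = 0 := by
    refine imageNorm_eq_zero.2 (funext fun q => ?_)
    change c * x q - x q * c = 0
    ring
  change 0 < relu ((δ / c) * imageNorm (shiftImage 0 x) - e (shiftImage 0 x))
  rw [shiftImage_zero, hex, ← hc, div_mul_cancel₀ _ hc0.ne', sub_zero]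
  exact lt_max_of_lt_left hδ0

end ReLU

/-! ### The approximation theorem -/

theorem theorem5 (d : ℕ) (hd : 1 ≤ d)
    (f : (Pixel d → ℝ) → ℝ) (hf : Continuous f)
    (hinv : ∀ π ∈ translations d, ∀ x : Pixel d → ℝ, f (fun p => x (π p)) = f x)
    (K : Set (Pixel d → ℝ)) (hK : IsCompact K) (ε : ℝ) (hε : 0 < ε) :
    (∀ σ : ℝ → ℝ, Continuous σ → (¬ ∃ p : Polynomial ℝ, ∀ t, σ t = p.eval t) →
      ∃ F : (Pixel d → ℝ) → ℝ,
        IsInvariantNetwork (translations d) LayerKind.affine σ (2 * d - 1) F ∧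
        ∀ x ∈ K, |F x - f x| < ε) ∧
    (∀ σ : ℝ → ℝ, (σ = relu ∨ σ = Real.sigmoid) →
      ∃ F : (Pixel d → ℝ) → ℝ,
        IsInvariantNetwork (translations d) LayerKind.linear σ (2 * d - 1) F ∧
        ∀ x ∈ K, |F x - f x| < ε) := by
  have : NeZero d := ⟨by omega⟩
  have hN : 1 ≤ 2 * d - 1 := by omega
  have hf' : ∀ g x, f (shiftImage g x) = f x := fun g x => hinv _ ⟨g, rfl⟩ x
  refine ⟨fun σ hσ hσp => ?_, fun σ hσ => ?_⟩
  -- Pixel values separate points before any activation, and biases supply the shifts, so one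
  -- activation layer is enough.
  · refine exists_isInvariantNetwork_of_separates_orbits hN 1 hσ hσp
      (exists_sumTranslates_ne_of_separates_points 0 hσ hσp (fun x y hxy => ?_) fun u hu b => ?_)
      f hf hf' K hK ε hε
    · obtain ⟨q, hq⟩ := Function.ne_iff.1 hxy
      exact ⟨_, apply_mem_featureSpace_zero q, hq⟩
    · exact activate_mem_featureSpace (Submodule.add_mem _ hu
        (Submodule.mem_sup_right ⟨b, fun h => (nomatch h), rfl⟩))
  · rcases hσ with rfl | rfl
    · exact exists_isInvariantNetwork_of_separates_orbits hN 3 continuous_relu not_polynomial_relu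
        exists_sumTranslates_ne_relu f hf hf' K hK ε hε
    -- One extra layer creates the constants; points remain separated there because the sigmoid is
    -- injective.
    · refine exists_isInvariantNetwork_of_separates_orbits hN 2 continuous_sigmoid
        Real.not_polynomial_sigmoid (exists_sumTranslates_ne_of_separates_points 1
        continuous_sigmoid Real.not_polynomial_sigmoid (fun x y hxy => ?_) fun u hu b => ?_)
        f hf hf' K hK ε hε
      · obtain ⟨q, hq⟩ := Function.ne_iff.1 hxy
        exact ⟨_, activate_mem_featureSpace (apply_mem_featureSpace_zero q),
          fun h => hq (Real.sigmoid_injective h)⟩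
      · exact activate_mem_featureSpace (Submodule.add_mem _ hu
          (const_mem_featureSpace_sigmoid_one b))
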